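/- Let $\mathcal{X}$ be a non-empty finite set. A gamble on a set $\Omega$ is a bounded map $f:\Omega\to\mathbb{R}$, and $\mathcal{L}(\Omega)$ is the linear space of all gambles on $\Omega$. A coherent lower prevision on a linear space $\mathcal{K}$ of gambles on a non-empty set $\Omega$ is a map $\underline{P}:\mathcal{K}\to\mathbb{R}$ with $\underline{P}(f)\ge\inf f$, $\underline{P}(\lambda f)=\lambda\underline{P}(f)$ and $\underline{P}(f+g)\ge\underline{P}(f)+\underline{P}(g)$ for all $f,g\in\mathcal{K}$ and all real $\lambda\ge 0$. A coherent lower prevision $\underline{P}^n$ on $\mathcal{L}(\mathcal{X}^n)$ is exchangeable if $\underline{P}^n(\pi f-f)\ge 0$ for every gamble $f$ on $\mathcal{X}^n$ and every permutation $\pi$ of $\{1,\dots,n\}$, where $(\pi f)(z_1,\dots,z_n)=f(z_{\pi(1)},\dots,z_{\pi(n)})$. A family $\underline{P}^n$ on $\mathcal{L}(\mathcal{X}^n)$, $n\ge 1$, is time consistent if $\underline{P}^n(f)=\underline{P}^{n+k}(\tilde f)$ for all $n\ge 1$, $k\ge 0$ and $f\in\mathcal{L}(\mathcal{X}^n)$,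 where $\tilde f(z_1,\dots,z_{n+k})=f(z_1,\dots,z_n)$. Let $\mathcal{N}^n=\{\mathbf{m}\in\mathbb{Z}_{\ge 0}^{\mathcal{X}}:\sum_{x\in\mathcal{X}}m_x=n\}$, let $\mathbf{T}^n:\mathcal{X}^n\to\mathcal{N}^n$ be given by $T^n_x(\mathbf{z})=|\{k:z_k=x\}|$, and let $\underline{Q}^n(g)=\underline{P}^n(g\circ\mathbf{T}^n)$ for $g\in\mathcal{L}(\mathcal{N}^n)$. Let $\Sigma=\{\theta\in\mathbb{R}^{\mathcal{X}}:\theta_x\ge 0 \text{ for all } x\in\mathcal{X},\ \sum_{x\in\mathcal{X}}\theta_x=1\}$, and let $\mathcal{V}(\Sigma)$ be the linear space of all restrictions to $\Sigma$ of real polynomials in the variables $\theta_x$, $x\in\mathcal{X}$. For $f\in\mathcal{L}(\mathcal{X}^n)$, $g\in\mathcal{L}(\mathcal{N}^n)$ and $\theta\in\Sigma$ put $$\mathrm{Mn}^n(f|\theta)=\sum_{\mathbf{z}\in\mathcal{X}^n}f(\mathbf{z})\prod_{x\in\mathcal{X}}\theta_x^{T^n_x(\mathbf{z})},\qquad \mathrm{CoMn}^n(g|\theta)=\sum_{\mathbf{m}\in\mathcal{N}^n}g(\mathbf{m})\,\frac{n!}{\prod_{x\in\mathcal{X}}m_x!}\prod_{x\in\mathcal{X}}\theta_x^{m_x}.$$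 Theorem (Representation theorem for exchangeable sequences). Given a time-consistent family of exchangeable coherent lower previsions $\underline{P}^n$ on $\mathcal{L}(\mathcal{X}^n)$, $n\ge 1$, there is a unique coherent lower prevision $\underline{R}$ on $\mathcal{V}(\Sigma)$ such that for all $n\ge 1$, all $f\in\mathcal{L}(\mathcal{X}^n)$ and all $g\in\mathcal{L}(\mathcal{N}^n)$, $$\underline{P}^n(f)=\underline{R}(\mathrm{Mn}^n(f|\cdot))\quad\text{and}\quad\underline{Q}^n(g)=\underline{R}(\mathrm{CoMn}^n(g|\cdot)).$$ -/

import Mathlib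

/-- The linear space `ℒ(Ω)` of all gambles (bounded real-valued maps) on `Ω`. -/
def gambles (Ω : Type*) : Submodule ℝ (Ω → ℝ) where
  carrier := {f | ∃ C : ℝ, ∀ ω, |f ω| ≤ C}
  zero_mem' := ⟨0, fun _ => by simp⟩
  add_mem' := by
    rintro f g ⟨C, hC⟩ ⟨D, hD⟩
    exact ⟨C + D, fun ω => (abs_add_le _ _).trans (add_le_add (hC ω) (hD ω))⟩
  smul_mem' := by
    rintro c f ⟨C, hC⟩
    refine ⟨|c| * C, fun ω => ?_⟩
    simpa [abs_mul] using mul_le_mul_of_nonneg_left (hC ω) (abs_nonneg c)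

/-- The gamble `f ∘ φ` on `A` that corresponds to a gamble `f` on `B` and a map `φ : A → B`. -/
def gambleComp {A B : Type*} (φ : A → B) (f : gambles B) : gambles A :=
  ⟨fun a => f.1 (φ a), by
    obtain ⟨C, hC⟩ := f.2
    exact ⟨C, fun a => hC (φ a)⟩⟩

/-- `P` is a coherent lower prevision on the linear space `K` of gambles on `Ω`: it accepts sure
gains, is non-negatively homogeneous, and is superadditive. -/
structure IsCoherentLowerPrevision {Ω : Type*} (K : Submodule ℝ (Ω → ℝ)) (P : K → ℝ) : Prop where
  domain_le : K ≤ gambles Ω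
  accepting_sure_gains : ∀ f : K, (⨅ ω, f.1 ω) ≤ P f
  nonneg_homogeneous : ∀ (c : ℝ) (f : K), 0 ≤ c → P (c • f) = c * P f
  superadditive : ∀ f g : K, P f + P g ≤ P (f + g)

/-- The permuted gamble `πf = f ∘ π`, with `π (z₁, …, z_N) = (z_{π(1)}, …, z_{π(N)})`. -/
def permuteGamble {X : Type*} {N : ℕ} (π : Equiv.Perm (Fin N)) (f : gambles (Fin N → X)) :
    gambles (Fin N → X) :=
  gambleComp (fun z i => z (π i)) f

/-- Exchangeability of a lower prevision on `ℒ(X^N)`: the subject is disposed to exchange any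
gamble `f` for the permuted gamble `πf`. -/
def IsExchangeable {X : Type*} {N : ℕ} (P : gambles (Fin N → X) → ℝ) : Prop :=
  ∀ (π : Equiv.Perm (Fin N)) (f : gambles (Fin N → X)), 0 ≤ P (permuteGamble π f - f)

/-- The cylindrical extension to `X^(n+k)` of a gamble on `X^n`. -/
def cylindricalExtension {X : Type*} {n : ℕ} (k : ℕ) (f : gambles (Fin n → X)) :
    gambles (Fin (n + k) → X) :=
  gambleComp (fun z i => z (Fin.castAdd k i)) f

/-- Time consistency of a family of lower previsions `P n` on `ℒ(X^n)`, `n ≥ 1`: each `P n` is the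
`X^n`-marginal of every `P (n + k)`. The value of the family at `n = 0` plays no role. -/
def IsTimeConsistent {X : Type*} (P : ∀ n : ℕ, gambles (Fin n → X) → ℝ) : Prop :=
  ∀ n : ℕ, 1 ≤ n → ∀ (k : ℕ) (f : gambles (Fin n → X)),
    P n f = P (n + k) (cylindricalExtension k f)

/-- The set of count vectors `m ∈ ℕ^X` with `∑ x, m x = N`. -/
def CountVector (X : Type*) [Fintype X] (N : ℕ) : Type _ :=
  {m : X → ℕ // ∑ x, m x = N}

instance CountVector.instFintype (X : Type*) [Fintype X] [DecidableEq X] (N : ℕ) :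
    Fintype (CountVector X N) :=
  Fintype.subtype (Finset.piAntidiag Finset.univ N) (fun m => by simp)

/-- The counting map `T^N : X^N → 𝒩^N`; its component `x` counts the occurrences of `x`. -/
def countingMap {X : Type*} [Fintype X] [DecidableEq X] {N : ℕ} (z : Fin N → X) :
    CountVector X N :=
  ⟨fun x => (Finset.univ.filter fun i => z i = x).card, by
    rw [← Finset.card_eq_sum_card_fiberwise (fun i _ => Finset.mem_univ (z i))]
    simp⟩

/-- The distribution `Q^N` of the count vector, induced by a lower prevision on `ℒ(X^N)`:
`Q^N(g) = P^N(g ∘ T^N)`. -/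
def countDistribution {X : Type*} [Fintype X] [DecidableEq X] {N : ℕ}
    (P : gambles (Fin N → X) → ℝ) (g : gambles (CountVector X N)) : ℝ :=
  P (gambleComp countingMap g)

/-- The space `𝒱(Σ)` of polynomial gambles on the `X`-simplex `Σ`: the restrictions to `Σ` of the
real polynomials in the variables `θ_x`, `x ∈ X`. -/
def polynomialGambles (X : Type*) [Fintype X] : Submodule ℝ (stdSimplex ℝ X → ℝ) where
  carrier := {h | ∃ p : MvPolynomial X ℝ, ∀ θ : stdSimplex ℝ X, h θ = MvPolynomial.eval θ.1 p}
  zero_mem' := ⟨0, fun _ => by simp⟩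
  add_mem' := by
    rintro f g ⟨p, hp⟩ ⟨q, hq⟩
    exact ⟨p + q, fun θ => by simp [hp, hq]⟩
  smul_mem' := by
    rintro c f ⟨p, hp⟩
    exact ⟨MvPolynomial.C c * p, fun θ => by simp [hp]⟩

/-- The count multinomial prevision `CoMn^n(g|θ) = ∑ m, g(m) ν(m) ∏ x, θ_x ^ m_x`, as a polynomial
gamble in `θ`; here `ν(m) = n! / ∏ x, m_x!`. -/
noncomputable def countMultinomial {X : Type*} [Fintype X] [DecidableEq X] (n : ℕ)
    (g : gambles (CountVector X n)) : polynomialGambles X :=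
  ⟨fun θ => ∑ m : CountVector X n,
      g.1 m * (Nat.multinomial Finset.univ m.1 : ℝ) * ∏ x, θ.1 x ^ m.1 x,
    ∑ m : CountVector X n,
      MvPolynomial.C (g.1 m * (Nat.multinomial Finset.univ m.1 : ℝ)) *
        ∏ x, MvPolynomial.X x ^ m.1 x,
    fun θ => by simp [map_sum, map_prod]⟩

/-- The multinomial prevision `Mn^n(f|θ)`: the expectation of `f(Y₁, …, Y_n)` for i.i.d. `Y_i` with
mass function `θ`, under which `z ∈ X^n` has probability `∏ x, θ_x ^ T_x(z)`; as a polynomial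
gamble in `θ`. -/
noncomputable def multinomialPrevision {X : Type*} [Fintype X] [DecidableEq X] (n : ℕ)
    (f : gambles (Fin n → X)) : polynomialGambles X :=
  ⟨fun θ => ∑ z : Fin n → X, f.1 z * ∏ x, θ.1 x ^ (countingMap z).1 x,
    ∑ z : Fin n → X, MvPolynomial.C (f.1 z) * ∏ x, MvPolynomial.X x ^ (countingMap z).1 x,
    fun θ => by simp [map_sum, map_prod]⟩

/-! The maps `multinomialPrevision n` are linear, unchanged by cylindrical extension, and together
reach every polynomial gamble. So `R h` must be `P n f` for any `f` representing `h`, which gives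
uniqueness. What remains is that this value is independent of `f` and coherent.

Both rest on one inequality, `le_of_forall_le_multinomialPrevision`: if `c ≤ Mn(f|θ)` for all `θ`,
then `c ≤ P k f`. To see it, view `f` as a gamble on `k + j` observations. Exchangeability lets it
be traded for `f` of any `k` distinct observations. Averaging over all draws with replacement
instead gives `Mn(f|·)` at the empirical mass function, which is at least `c`. Draws with
repetitions cost a bounded amount, and their proportion vanishes as `j → ∞`. -/

/-- Every real map on a finite type is a gamble. -/
theorem gambles_eq_top {Ω : Type*} [Finite Ω] : gambles Ω = ⊤ := by
  refine eq_top_iff.2 fun f _ => ?_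
  cases nonempty_fintype Ω
  exact ⟨∑ ω, |f ω|, fun ω =>
    Finset.single_le_sum (f := fun ω => |f ω|) (fun _ _ => abs_nonneg _) (Finset.mem_univ ω)⟩

/-- A real map on a finite type, as a gamble. -/
def finiteGamble {Ω : Type*} [Finite Ω] (f : Ω → ℝ) : gambles Ω :=
  ⟨f, gambles_eq_top (Ω := Ω) ▸ Submodule.mem_top⟩

/-! ### Multinomial previsions and polynomial gambles -/

theorem prod_pow_countingMap {X M : Type*} [Fintype X] [DecidableEq X] [CommMonoid M] {n : ℕ}
    (θ : X → M) (z : Fin n → X) :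
    ∏ x, θ x ^ (countingMap z).1 x = ∏ i, θ (z i) := by
  rw [← Finset.prod_fiberwise' Finset.univ z θ]
  simp [countingMap]

theorem multinomialPrevision_apply {X : Type*} [Fintype X] [DecidableEq X] {n : ℕ}
    (f : gambles (Fin n → X)) (θ : stdSimplex ℝ X) :
    (multinomialPrevision n f).1 θ = ∑ z, f.1 z * ∏ i, θ.1 (z i) := by
  simp only [multinomialPrevision, prod_pow_countingMap]

theorem multinomialPrevision_add {X : Type*} [Fintype X] [DecidableEq X] {n : ℕ}
    (f g : gambles (Fin n → X)) :
    multinomialPrevision n (f + g) = multinomialPrevision n f + multinomialPrevision n g := by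
  ext θ
  simp [multinomialPrevision_apply, add_mul, Finset.sum_add_distrib]

theorem multinomialPrevision_smul {X : Type*} [Fintype X] [DecidableEq X] {n : ℕ} (c : ℝ)
    (f : gambles (Fin n → X)) :
    multinomialPrevision n (c • f) = c • multinomialPrevision n f := by
  ext θ
  simp [multinomialPrevision_apply, mul_assoc, Finset.mul_sum]

theorem multinomialPrevision_sub {X : Type*} [Fintype X] [DecidableEq X] {n : ℕ}
    (f g : gambles (Fin n → X)) :
    multinomialPrevision n (f - g) = multinomialPrevision n f - multinomialPrevision n g := by
  ext θ
  simp [multinomialPrevision_apply, sub_mul, Finset.sum_sub_distrib]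

theorem sum_prod_stdSimplex {X : Type*} [Fintype X] (n : ℕ) (θ : stdSimplex ℝ X) :
    ∑ z : Fin n → X, ∏ i, θ.1 (z i) = 1 := by
  rw [← Fintype.sum_pow, θ.2.2, one_pow]

/-- Disjoint blocks of i.i.d. observations are independent, so expectations multiply. -/
theorem multinomialPrevision_append {X : Type*} [Fintype X] [DecidableEq X] {n k : ℕ}
    (f : gambles (Fin n → X)) (g : gambles (Fin k → X)) (θ : stdSimplex ℝ X) :
    (multinomialPrevision (n + k) (finiteGamble fun z =>
      f.1 (fun i => z (Fin.castAdd k i)) * g.1 (fun i => z (Fin.natAdd n i)))).1 θ =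
      (multinomialPrevision n f).1 θ * (multinomialPrevision k g).1 θ := by
  simp only [multinomialPrevision_apply, Finset.sum_mul_sum, ← Fintype.sum_prod_type']
  refine (Fintype.sum_equiv (Fin.appendEquiv n k) _ _ fun p => ?_).symm
  simp only [finiteGamble, Fin.prod_univ_add, Fin.appendEquiv, Equiv.coe_fn_mk, Fin.append_left,
    Fin.append_right]
  ring

theorem multinomialPrevision_cylindricalExtension {X : Type*} [Fintype X] [DecidableEq X]
    {n : ℕ} (k : ℕ) (f : gambles (Fin n → X)) :
    multinomialPrevision (n + k) (cylindricalExtension k f) = multinomialPrevision n f := by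
  ext θ
  have h := multinomialPrevision_append f (finiteGamble fun _ : Fin k → X => (1 : ℝ)) θ
  have h1 : (multinomialPrevision k (finiteGamble fun _ : Fin k → X => (1 : ℝ))).1 θ = 1 := by
    simp [multinomialPrevision_apply, finiteGamble, sum_prod_stdSimplex]
  rw [h1, mul_one] at h
  rw [← h]
  refine congrArg (fun u => (multinomialPrevision (n + k) u).1 θ) (Subtype.ext (funext fun z => ?_))
  simp [cylindricalExtension, gambleComp, finiteGamble]

/-- The number of sequences with a given count vector is the multinomial coefficient. -/
theorem card_countingMap_eq {X : Type*} [Fintype X] [DecidableEq X] {n : ℕ}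
    (m : CountVector X n) :
    (Finset.univ.filter fun z : Fin n → X => (countingMap z).1 = m.1).card =
      Nat.multinomial Finset.univ m.1 := by
  have hmon : ∀ a : X → ℕ, ∏ x, (MvPolynomial.X x : MvPolynomial X ℤ) ^ a x =
      MvPolynomial.monomial (Finsupp.equivFunOnFinite.symm a) 1 := fun a => by
    rw [MvPolynomial.monomial_eq, Finsupp.prod_fintype _ _ (by simp)]
    simp
  -- Expand `(∑ x, X x) ^ n` over sequences and by the multinomial theorem, then compare
  -- coefficients at `m`.
  have h := (Fintype.sum_pow (fun x => (MvPolynomial.X x : MvPolynomial X ℤ)) n).symm.trans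
    (Finset.sum_pow_eq_sum_piAntidiag Finset.univ _ n)
  replace h := congrArg (MvPolynomial.coeff (Finsupp.equivFunOnFinite.symm m.1)) h
  simp only [← prod_pow_countingMap, hmon, MvPolynomial.coeff_sum, ← MvPolynomial.C_eq_coe_nat,
    MvPolynomial.coeff_C_mul, MvPolynomial.coeff_monomial,
    Finsupp.equivFunOnFinite.symm.injective.eq_iff] at h
  rw [Finset.sum_boole] at h
  simp only [mul_ite, mul_one, mul_zero, Finset.sum_ite_eq'] at h
  rw [if_pos (by simpa using m.2)] at h
  exact_mod_cast h

/-- The count multinomial prevision of `g` is the multinomial prevision of `g ∘ T`. -/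
theorem multinomialPrevision_gambleComp_countingMap {X : Type*} [Fintype X] [DecidableEq X]
    {n : ℕ} (g : gambles (CountVector X n)) :
    multinomialPrevision n (gambleComp countingMap g) = countMultinomial n g := by
  classical
  ext θ
  simp only [multinomialPrevision, countMultinomial, gambleComp]
  rw [← Finset.sum_fiberwise Finset.univ (countingMap (X := X) (N := n))]
  refine Finset.sum_congr rfl fun m _ => ?_
  rw [Finset.sum_congr rfl (g := fun _ => g.1 m * ∏ x, θ.1 x ^ m.1 x), Finset.sum_const,
    nsmul_eq_mul, ← card_countingMap_eq m]
  · have : (Finset.univ.filter fun z : Fin n → X => countingMap z = m) =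
        Finset.univ.filter fun z : Fin n → X => (countingMap z).1 = m.1 :=
      Finset.filter_congr fun z _ => Subtype.ext_iff
    rw [this]
    ring
  · intro z hz
    rw [(Finset.mem_filter.1 hz).2]

/-- Every polynomial gamble is the multinomial prevision of some gamble on a finite power. -/
theorem exists_multinomialPrevision_eq {X : Type*} [Fintype X] [DecidableEq X]
    (h : polynomialGambles X) :
    ∃ n, 1 ≤ n ∧ ∃ f : gambles (Fin n → X), multinomialPrevision n f = h := by
  obtain ⟨h, p, hp⟩ := h
  suffices H : ∃ n, 1 ≤ n ∧ ∃ f : gambles (Fin n → X),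
      ∀ θ : stdSimplex ℝ X, (multinomialPrevision n f).1 θ = MvPolynomial.eval θ.1 p by
    obtain ⟨n, hn, f, hf⟩ := H
    exact ⟨n, hn, f, Subtype.ext (funext fun θ => (hf θ).trans (hp θ).symm)⟩
  clear hp h
  induction p using MvPolynomial.induction_on with
  | C a =>
    -- Length 1, not 0, because nothing is assumed about the family at 0.
    refine ⟨1, le_rfl, finiteGamble fun _ => a, fun θ => ?_⟩
    rw [multinomialPrevision_apply]
    simp only [finiteGamble, ← Finset.mul_sum, sum_prod_stdSimplex, mul_one, MvPolynomial.eval_C]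
  | add p q hp hq =>
    obtain ⟨n, hn, f, hf⟩ := hp
    obtain ⟨k, hk, g, hg⟩ := hq
    -- The summands are placed on disjoint blocks, which brings them to a common length.
    refine ⟨n + k, by omega, cylindricalExtension k f +
      finiteGamble fun z => g.1 fun i => z (Fin.natAdd n i), fun θ => ?_⟩
    have h := multinomialPrevision_append (finiteGamble fun _ : Fin n → X => (1 : ℝ)) g θ
    have h1 : (multinomialPrevision n (finiteGamble fun _ : Fin n → X => (1 : ℝ))).1 θ = 1 := by
      simp [multinomialPrevision_apply, finiteGamble, sum_prod_stdSimplex]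
    rw [h1] at h
    simp only [finiteGamble, one_mul] at h
    rw [multinomialPrevision_add, multinomialPrevision_cylindricalExtension, map_add, ← hf, ← hg,
      ← h]
    rfl
  | mul_X p x hp =>
    obtain ⟨n, hn, f, hf⟩ := hp
    -- The indicator of `x` on one further observation has expectation `θ_x`.
    refine ⟨n + 1, by omega, _, fun θ => (multinomialPrevision_append f
      (finiteGamble fun z => if z 0 = x then 1 else 0) θ).trans ?_⟩
    rw [hf, map_mul, MvPolynomial.eval_X]
    congr 1
    rw [multinomialPrevision_apply, ← (Equiv.funUnique (Fin 1) X).symm.sum_comp]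
    rw [Fintype.sum_eq_single x fun y hy => by simp [finiteGamble, hy]]
    simp [finiteGamble]

-- The ratio bounds from below the proportion of repetition-free draws of `k` from `k + j` items.
open Filter Topology in
theorem tendsto_add_one_div_add_pow (k : ℕ) :
    Tendsto (fun j : ℕ => (((j + 1 : ℕ) : ℝ) / ((k + j : ℕ) : ℝ)) ^ k) atTop (𝓝 1) := by
  have h : Tendsto (fun j : ℕ => ((j + 1 : ℕ) : ℝ) / ((k + j : ℕ) : ℝ)) atTop (𝓝 1) := by
    have h := tendsto_add_mul_div_add_mul_atTop_nhds (1 : ℝ) (k : ℝ) (1 : ℝ) (d := 1) one_ne_zero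
    simp only [one_mul, div_one] at h
    refine h.congr fun j => ?_
    push_cast
    rw [add_comm (1 : ℝ)]
  simpa using h.pow k

namespace IsCoherentLowerPrevision

variable {Ω : Type*} {K : Submodule ℝ (Ω → ℝ)} {P : K → ℝ}

theorem le_of_forall_le [Nonempty Ω] (h : IsCoherentLowerPrevision K P) {f : K} {c : ℝ}
    (hf : ∀ ω, c ≤ f.1 ω) : c ≤ P f :=
  (le_ciInf hf).trans (h.accepting_sure_gains f)

theorem sum_le (h : IsCoherentLowerPrevision K P) {ι : Type*} (s : Finset ι) (f : ι → K) :
    ∑ i ∈ s, P (f i) ≤ P (∑ i ∈ s, f i) := by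
  classical
  induction s using Finset.induction_on with
  | empty => simpa using (h.nonneg_homogeneous 0 0 le_rfl).ge
  | insert a s ha ih =>
    rw [Finset.sum_insert ha, Finset.sum_insert ha]
    exact (add_le_add le_rfl ih).trans (h.superadditive _ _)

end IsCoherentLowerPrevision

/-! ### Sampling with and without replacement -/

/-- The empirical mass function of a sequence. -/
noncomputable def empiricalMass {X : Type*} [Fintype X] [DecidableEq X] {n : ℕ} (hn : 1 ≤ n)
    (z : Fin n → X) : stdSimplex ℝ X :=
  ⟨fun x => ∑ j, if z j = x then (n : ℝ)⁻¹ else 0, fun x => Finset.sum_nonneg fun j _ => by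
    split_ifs <;> positivity, by
    rw [Finset.sum_comm]
    have : (n : ℝ) ≠ 0 := by positivity
    simp [this]⟩

/-- The multinomial prevision at an empirical mass function is an average over all samples with
replacement. -/
theorem multinomialPrevision_empiricalMass {X : Type*} [Fintype X] [DecidableEq X] {n k : ℕ}
    (hn : 1 ≤ n) (f : gambles (Fin k → X)) (z : Fin n → X) :
    (multinomialPrevision k f).1 (empiricalMass hn z) =
      ((n : ℝ) ^ k)⁻¹ * ∑ σ : Fin k → Fin n, f.1 (fun i => z (σ i)) := by
  rw [multinomialPrevision_apply]
  -- Expanding the product gives one term per draw `σ`; its indicators leave only the sequence `z ∘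
  -- σ`.
  simp only [empiricalMass, Fintype.prod_sum, Finset.mul_sum]
  rw [Finset.sum_comm]
  refine Finset.sum_congr rfl fun σ _ => ?_
  simp only [Fintype.prod_ite_zero, ← funext_iff, Finset.prod_const, Finset.card_univ,
    Fintype.card_fin, mul_ite, mul_zero]
  rw [Finset.sum_ite_eq Finset.univ (fun i => z (σ i))]
  simp [mul_comm]

/-- Sampling without replacement does not change the value of an exchangeable prevision. -/
theorem IsExchangeable.nonneg_cylindricalExtension_sub {X : Type*} {k j : ℕ}
    {P : gambles (Fin (k + j) → X) → ℝ} (h : IsExchangeable P) (f : gambles (Fin k → X))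
    {σ : Fin k → Fin (k + j)} (hσ : Function.Injective σ) :
    0 ≤ P (cylindricalExtension j f - gambleComp (fun z i => z (σ i)) f) := by
  -- `π` sends each `σ i` to position `i`, so permuting `f(z ∘ σ)` by `π` gives the cylindrical
  -- extension.
  obtain ⟨π, hπ⟩ := Equiv.Perm.exists_extending_pair σ (Fin.castAdd j) hσ
    (Fin.castAdd_injective k j)
  have := h π (gambleComp (fun z i => z (σ i)) f)
  convert! this using 3
  refine Subtype.ext (funext fun z => ?_)
  simp [cylindricalExtension, permuteGamble, gambleComp, hπ]

/-- The count is `(k + j) ⋯ (j + 1)`, with `k` factors each at least `j + 1`. -/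
theorem pow_le_card_injective (k j : ℕ) :
    (j + 1) ^ k ≤
      (Finset.univ.filter fun σ : Fin k → Fin (k + j) => Function.Injective σ).card := by
  rw [← Fintype.card_subtype, Fintype.card_congr (Equiv.subtypeInjectiveEquivEmbedding _ _),
    Fintype.card_embedding_eq, Fintype.card_fin, Fintype.card_fin]
  have := Nat.pow_sub_le_descFactorial (k + j) k
  rwa [show k + j + 1 - k = j + 1 by omega] at this

/-- A lower bound for an exchangeable prevision from a lower bound of the multinomial prevision,
with an error that comes from replacing samples with replacement by ones without. -/
theorem IsCoherentLowerPrevision.sub_le_cylindricalExtension {X : Type*} [Fintype X]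
    [DecidableEq X] [Nonempty X] {k j : ℕ} (hk : 1 ≤ k) {P : gambles (Fin (k + j) → X) → ℝ}
    (hP : IsCoherentLowerPrevision (gambles (Fin (k + j) → X)) P) (hex : IsExchangeable P)
    (f : gambles (Fin k → X)) {c C : ℝ} (hC : ∀ z, |f.1 z| ≤ C)
    (hc : ∀ θ, c ≤ (multinomialPrevision k f).1 θ) :
    c - 2 * C * (1 - (((j + 1 : ℕ) : ℝ) / ((k + j : ℕ) : ℝ)) ^ k) ≤
      P (cylindricalExtension j f) := by
  classical
  have hn : 1 ≤ k + j := by omega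
  have hN : (0 : ℝ) < ((k + j : ℕ) : ℝ) ^ k := by positivity
  have hC0 : 0 ≤ C := (abs_nonneg _).trans (hC fun _ => Classical.arbitrary X)
  set N : ℝ := ((k + j : ℕ) : ℝ) ^ k with hNdef
  let g : (Fin k → Fin (k + j)) → gambles (Fin (k + j) → X) :=
    fun σ => gambleComp (fun z i => z (σ i)) f
  have hcard : (Fintype.card (Fin k → Fin (k + j)) : ℝ) = N := by simp [hNdef]
  -- The average over draws with replacement, plus the average gain from exchanging it for `f`.
  have hsplit : cylindricalExtension j f =
      N⁻¹ • ∑ σ, g σ + N⁻¹ • ∑ σ, (cylindricalExtension j f - g σ) := by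
    rw [Finset.sum_sub_distrib, smul_sub, add_sub_cancel, Finset.sum_const, Finset.card_univ,
      ← Nat.cast_smul_eq_nsmul ℝ, hcard, smul_smul, inv_mul_cancel₀ hN.ne', one_smul]
  have hA : c ≤ P (N⁻¹ • ∑ σ, g σ) := by
    refine hP.le_of_forall_le fun z => (hc (empiricalMass hn z)).trans_eq ?_
    rw [multinomialPrevision_empiricalMass]
    simp [g, gambleComp, hNdef]
  have hσ : ∀ σ, (if Function.Injective σ then 0 else -(2 * C)) ≤
      P (cylindricalExtension j f - g σ) := fun σ => by
    split_ifs with hinj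
    · exact hex.nonneg_cylindricalExtension_sub f hinj
    · refine hP.le_of_forall_le fun z => ?_
      have h1 := abs_le.1 (hC fun i => z (Fin.castAdd j i))
      have h2 := abs_le.1 (hC fun i => z (σ i))
      simp only [g, cylindricalExtension, gambleComp, AddSubgroupClass.coe_sub, Pi.sub_apply]
      linarith
  have hI : ((j + 1 : ℕ) : ℝ) ^ k ≤
      ((Finset.univ.filter fun σ : Fin k → Fin (k + j) => Function.Injective σ).card : ℝ) := by
    exact_mod_cast pow_le_card_injective k j
  have hsum : -(2 * C) * (N - ((j + 1 : ℕ) : ℝ) ^ k) ≤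
      P (∑ σ, (cylindricalExtension j f - g σ)) := by
    refine le_trans ?_ ((Finset.sum_le_sum fun σ _ => hσ σ).trans (hP.sum_le _ _))
    have h3 := Finset.card_filter_add_card_filter_not (s := Finset.univ)
      (fun σ : Fin k → Fin (k + j) => Function.Injective σ)
    rw [Finset.card_univ] at h3
    have h4 : ((Finset.univ.filter fun σ : Fin k → Fin (k + j) => Function.Injective σ).card : ℝ) +
      ((Finset.univ.filter fun σ : Fin k → Fin (k + j) => ¬ Function.Injective σ).card : ℝ) = N := by
      rw [← hcard]; exact_mod_cast h3
    rw [Finset.sum_ite, Finset.sum_const_zero, zero_add, Finset.sum_const, nsmul_eq_mul]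
    -- At most `N - (j + 1) ^ k` draws have repetitions, and `hC0` fixes the sign.
    nlinarith
  have hB : -(2 * C) * (1 - (((j + 1 : ℕ) : ℝ) / ((k + j : ℕ) : ℝ)) ^ k) ≤
      P (N⁻¹ • ∑ σ, (cylindricalExtension j f - g σ)) := by
    rw [hP.nonneg_homogeneous _ _ (by positivity), div_pow, ← hNdef]
    calc _ = N⁻¹ * (-(2 * C) * (N - ((j + 1 : ℕ) : ℝ) ^ k)) := by field_simp
      _ ≤ _ := mul_le_mul_of_nonneg_left hsum (by positivity)
  rw [hsplit]
  refine le_trans ?_ (hP.superadditive _ _)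
  linarith

/-! ### Existence and uniqueness of the representation -/

/-- A time-consistent exchangeable family is bounded below by the infimum of the multinomial
prevision over the simplex. -/
theorem le_of_forall_le_multinomialPrevision {X : Type*} [Fintype X] [DecidableEq X] [Nonempty X]
    {P : ∀ n : ℕ, gambles (Fin n → X) → ℝ}
    (hcoh : ∀ n : ℕ, 1 ≤ n → IsCoherentLowerPrevision (gambles (Fin n → X)) (P n))
    (hexch : ∀ n : ℕ, 1 ≤ n → IsExchangeable (P n))
    (htime : IsTimeConsistent P) {k : ℕ} (hk : 1 ≤ k) (f : gambles (Fin k → X)) {c : ℝ}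
    (hc : ∀ θ, c ≤ (multinomialPrevision k f).1 θ) : c ≤ P k f := by
  obtain ⟨C, hC⟩ := f.2
  have ht := ((tendsto_add_one_div_add_pow k).const_sub 1).const_mul (2 * C) |>.const_sub c
  rw [sub_self, mul_zero, sub_zero] at ht
  refine le_of_tendsto' ht fun j => ?_
  rw [htime k hk j f]
  exact (hcoh _ (by omega)).sub_le_cylindricalExtension hk (hexch _ (by omega)) f hC hc

/-- The values of a time-consistent exchangeable family depend only on the multinomial
prevision; by symmetry, one inequality is enough. -/
theorem le_of_multinomialPrevision_eq {X : Type*} [Fintype X] [DecidableEq X] [Nonempty X]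
    {P : ∀ n : ℕ, gambles (Fin n → X) → ℝ}
    (hcoh : ∀ n : ℕ, 1 ≤ n → IsCoherentLowerPrevision (gambles (Fin n → X)) (P n))
    (hexch : ∀ n : ℕ, 1 ≤ n → IsExchangeable (P n))
    (htime : IsTimeConsistent P) {n k : ℕ} (hn : 1 ≤ n) (hk : 1 ≤ k)
    {f : gambles (Fin n → X)} {g : gambles (Fin k → X)}
    (h : multinomialPrevision n f = multinomialPrevision k g) : P n f ≤ P k g := by
  have same : ∀ {m : ℕ} (_ : 1 ≤ m) {u v : gambles (Fin m → X)},
      multinomialPrevision m u = multinomialPrevision m v → P m u ≤ P m v := by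
    intro m hm u v huv
    -- The lower bound with `c = 0`, since `v - u` has zero multinomial prevision.
    have h0 : 0 ≤ P m (v - u) :=
      le_of_forall_le_multinomialPrevision hcoh hexch htime hm _ fun θ => by
        rw [multinomialPrevision_sub, huv, sub_self]; exact le_rfl
    have h1 := (hcoh m hm).superadditive u (v - u)
    rw [add_sub_cancel] at h1
    linarith
  -- The two extensions live over `n + k` and `k + n`, which are different types.
  have cast : ∀ {a b : ℕ} (_ : a = b) (u : gambles (Fin a → X)), ∃ v : gambles (Fin b → X),
      multinomialPrevision b v = multinomialPrevision a u ∧ P b v = P a u := by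
    rintro a _ rfl u
    exact ⟨u, rfl, rfl⟩
  obtain ⟨v, hv, hPv⟩ := cast (add_comm k n) (cylindricalExtension n g)
  rw [htime n hn k f, htime k hk n g, ← hPv]
  refine same (by omega) ?_
  rw [hv, multinomialPrevision_cylindricalExtension, multinomialPrevision_cylindricalExtension, h]

theorem theorem5 {X : Type*} [Fintype X] [DecidableEq X] [Nonempty X]
    (P : ∀ n : ℕ, gambles (Fin n → X) → ℝ)
    (hcoh : ∀ n : ℕ, 1 ≤ n → IsCoherentLowerPrevision (gambles (Fin n → X)) (P n))
    (hexch : ∀ n : ℕ, 1 ≤ n → IsExchangeable (P n))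
    (htime : IsTimeConsistent P) :
    ∃! R : polynomialGambles X → ℝ,
      IsCoherentLowerPrevision (polynomialGambles X) R ∧
      ∀ n : ℕ, 1 ≤ n →
        ∀ (f : gambles (Fin n → X)) (g : gambles (CountVector X n)),
          P n f = R (multinomialPrevision n f) ∧
          countDistribution (P n) g = R (countMultinomial n g) := by
  choose d hd r hr using exists_multinomialPrevision_eq (X := X)
  have key : ∀ {n : ℕ}, 1 ≤ n → ∀ {f : gambles (Fin n → X)} {h : polynomialGambles X},
      multinomialPrevision n f = h → P (d h) (r h) = P n f := fun hn f h hf =>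
    le_antisymm
      (le_of_multinomialPrevision_eq hcoh hexch htime (hd h) hn ((hr h).trans hf.symm))
      (le_of_multinomialPrevision_eq hcoh hexch htime hn (hd h) (hf.trans (hr h).symm))
  have hbdd : polynomialGambles X ≤ gambles (stdSimplex ℝ X) := by
    intro h hh
    obtain ⟨C, hC⟩ := (r ⟨h, hh⟩).2
    refine ⟨C, fun θ => ?_⟩
    rw [show h θ = _ from (congrArg (fun u => u.1 θ) (hr ⟨h, hh⟩)).symm,
      multinomialPrevision_apply]
    have hθ : ∀ z : Fin (d ⟨h, hh⟩) → X, 0 ≤ ∏ i, θ.1 (z i) := fun z =>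
      Finset.prod_nonneg fun i _ => θ.2.1 _
    calc _ ≤ ∑ z, |(r ⟨h, hh⟩).1 z * ∏ i, θ.1 (z i)| := Finset.abs_sum_le_sum_abs _ _
      _ ≤ ∑ z : Fin (d ⟨h, hh⟩) → X, C * ∏ i, θ.1 (z i) := Finset.sum_le_sum fun z _ => by
        rw [abs_mul, abs_of_nonneg (hθ z)]
        exact mul_le_mul_of_nonneg_right (hC z) (hθ z)
      _ = C := by rw [← Finset.mul_sum, sum_prod_stdSimplex, mul_one]
  refine ⟨fun h => P (d h) (r h), ⟨⟨hbdd, fun h => ?_, fun c h hc => ?_, fun h₁ h₂ => ?_⟩,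
    fun n hn f g => ⟨(key hn rfl).symm,
      (key hn (multinomialPrevision_gambleComp_countingMap g)).symm⟩⟩, ?_⟩
  -- Boundedness is needed for the real infimum to be a genuine lower bound.
  · obtain ⟨C, hC⟩ := hbdd h.2
    refine le_of_forall_le_multinomialPrevision hcoh hexch htime (hd h) _ fun θ => ?_
    rw [hr h]
    exact ciInf_le ⟨-C, Set.forall_mem_range.2 fun θ => (abs_le.1 (hC θ)).1⟩ θ
  · rw [← (hcoh _ (hd h)).nonneg_homogeneous c _ hc]
    exact key (hd h) (by rw [multinomialPrevision_smul, hr])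
  -- Both gambles get representatives of the same length, where superadditivity of `P` applies.
  · have h2 : 1 ≤ d h₁ + d h₂ := (hd h₁).trans (Nat.le_add_right _ _)
    have e₂ : ∃ u : gambles (Fin (d h₁ + d h₂) → X),
        multinomialPrevision (d h₁ + d h₂) u = h₂ := by
      rw [add_comm]
      exact ⟨_, (multinomialPrevision_cylindricalExtension (d h₁) (r h₂)).trans (hr h₂)⟩
    obtain ⟨u, hu⟩ := e₂
    have hs := (multinomialPrevision_cylindricalExtension (d h₂) (r h₁)).trans (hr h₁)
    rw [key h2 hs, key h2 hu, key (f := cylindricalExtension (d h₂) (r h₁) + u) h2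
      (by rw [multinomialPrevision_add, hs, hu])]
    exact (hcoh _ h2).superadditive _ _
  · rintro R ⟨-, hR⟩
    funext h
    have := (hR _ (hd h) (r h) 0).1
    rw [hr h] at this
    exact this.symm
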